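/- A group $G$ has the \emph{Bergman property} (is \emph{Bergman}) if, whenever $W_0\subseteq W_1\subseteq W_2\subseteq\cdots$ is an increasing sequence of subsets of $G$ with $\bigcup_n W_n=G$, there are $n$ and $k$ such that $G=W_n^k$, where $W_n^k$ is the set of all products of $k$ elements of $W_n$. Let $S^1=\mathbb{R}/\mathbb{Z}$, and let $\mathcal{C}\subseteq S^1$ be any countable dense subset (for example, the image of $\mathbb{Q}$). Let $B$ be the ternary relation on $\mathcal{C}$ such that $B(x,y,z)$ holds if and only if $x,y,z$ are distinct and, going clockwise along $S^1$ from $x$ to $z$, one passes through $y$. Let $\mathrm{Aut}(\mathcal{C})$ be the group of all permutations $g$ of $\mathcal{C}$ that preserve $B$, i.e. $B(gx,gy,gz)\Leftrightarrow B(x,y,z)$ for all $x,y,z\in\mathcal{C}$. Let $\mathrm{Hom}(S^1)$ be the group of all homeomorphisms of $S^1$ onto itself, orientation preserving or not. Theorem. $\mathrm{Aut}(\mathcal{C})$ and $\mathrm{Hom}(S^1)$ are Bergman. -/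

import Mathlib

open scoped Pointwise

/-- A group `G` has the Bergman property if for every increasing sequence
`W 0 ⊆ W 1 ⊆ …` of subsets of `G` with union `G` there are `n` and `k` such that
`G = W n ^ k`, where `W n ^ k` is the set of all products of `k` elements of `W n`. -/
def IsBergman (G : Type*) [Group G] : Prop :=
  ∀ W : ℕ → Set G, Monotone W → ⋃ n, W n = Set.univ → ∃ n k : ℕ, W n ^ k = Set.univ

namespace CircleOrder

/-- `CWBetween x y z`: the points `x`, `y`, `z` of the circle `ℝ/ℤ` are distinct and going
clockwise along the circle from `x` to `z` one passes through `y`. Mathlib's strict circular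
order `sbtw` on `ℝ/ℤ` is the counterclockwise one (the direction of increasing reals), and
clockwise from `x` via `y` to `z` is counterclockwise from `z` via `y` to `x`. -/
def CWBetween (x y z : UnitAddCircle) : Prop :=
  sbtw z y x

/-- The automorphism group of the circular order on a set `C` of points of the circle:
all permutations of `C` that preserve the ternary relation `CWBetween`. -/
def aut (C : Set UnitAddCircle) : Subgroup (Equiv.Perm C) where
  carrier := {g | ∀ x y z : C, CWBetween (g x) (g y) (g z) ↔ CWBetween x y z}
  one_mem' := fun _ _ _ => Iff.rfl
  mul_mem' := fun {a b} ha hb x y z => (ha (b x) (b y) (b z)).trans (hb x y z)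
  inv_mem' := fun {a} ha x y z => by
    have h := ha (a⁻¹ x) (a⁻¹ y) (a⁻¹ z)
    simp only [← Equiv.Perm.mul_apply, mul_inv_cancel, Equiv.Perm.one_apply] at h
    exact h.symm

end CircleOrder

/-!
A group is Bergman as soon as each of its length functions is bounded: along `W` one gets a
filtration by the powers `U n ^ 2 ^ n` of the symmetrised sets `U n`, and the index at which an
element enters the filtration is a length function.

For an interval `I` of an ordered field `K`, choose an automorphism `t` with bounded support that
moves `I` off itself. Every `h` supported in `I` is then a commutator `⁅a, t⁆`, where `a` is the
product of the conjugates of `h` by the powers of `t`. If a length function were unbounded on such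
`h`, one could place the elements `a` coming from a fast growing sequence of `h` side by side on
disjoint intervals; the resulting single automorphism would bound the sequence, a contradiction.

Adding a point at infinity turns `K` into a circle on which `x ↦ -x⁻¹` acts. This map carries the
interval `(0, 1)` to the half-line `(-∞, -1)`, so lengths are bounded on the automorphisms supported
in a half-line, hence on those fixing a point, hence on all of `Aut(K, <)` and, by a Bruhat
decomposition, on the automorphism group of the circle. By Cantor's theorem the case `K = ℚ`
is `Aut(𝒞)`; the case `K = ℝ` gives the orientation preserving homeomorphisms of the circle, to
which one adds a reflection.
-/

open Set
open scoped commutatorElement Function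

section StronglyBounded

variable {G H : Type*} [Group G] [Group H]

/-- A length function on a group: subadditive and non-increasing under inversion, but not required
to vanish at `1`. The values are natural numbers so that the sublevel sets exhaust the group along
a sequence, as in the definition of the Bergman property. -/
structure IsLength (ℓ : G → ℕ) : Prop where
  mul_le : ∀ g h, ℓ (g * h) ≤ ℓ g + ℓ h
  inv_le : ∀ g, ℓ g⁻¹ ≤ ℓ g

/-- A subset of a group is strongly bounded if every length function on the group is bounded on
it. -/
def IsStronglyBounded (A : Set G) : Prop :=
  ∀ ℓ : G → ℕ, IsLength ℓ → ∃ B, ∀ g ∈ A, ℓ g ≤ B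

theorem IsLength.comp {ℓ : H → ℕ} (hℓ : IsLength ℓ) (φ : G →* H) : IsLength (ℓ ∘ φ) where
  mul_le g h := by simpa using hℓ.mul_le (φ g) (φ h)
  inv_le g := by simpa using hℓ.inv_le (φ g)

theorem IsLength.commutatorElement_le {ℓ : G → ℕ} (hℓ : IsLength ℓ) (g h : G) :
    ℓ ⁅g, h⁆ ≤ 2 * ℓ g + 2 * ℓ h := by
  have hgh := hℓ.mul_le g h
  have hghg := hℓ.mul_le (g * h) g⁻¹
  have hghgh := hℓ.mul_le (g * h * g⁻¹) h⁻¹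
  have hg := hℓ.inv_le g
  have hh := hℓ.inv_le h
  rw [commutatorElement_def]
  omega

namespace IsStronglyBounded

variable {A B : Set G}

theorem mono (hB : IsStronglyBounded B) (h : A ⊆ B) : IsStronglyBounded A := fun ℓ hℓ =>
  (hB ℓ hℓ).imp fun _ hb g hg => hb g (h hg)

theorem singleton (g : G) : IsStronglyBounded {g} := fun ℓ _ =>
  ⟨ℓ g, fun _ h => (congrArg ℓ h).le⟩

theorem union (hA : IsStronglyBounded A) (hB : IsStronglyBounded B) :
    IsStronglyBounded (A ∪ B) := fun ℓ hℓ => by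
  obtain ⟨a, ha⟩ := hA ℓ hℓ
  obtain ⟨b, hb⟩ := hB ℓ hℓ
  refine ⟨max a b, ?_⟩
  rintro g (hg | hg)
  · exact (ha g hg).trans (le_max_left a b)
  · exact (hb g hg).trans (le_max_right a b)

theorem mul (hA : IsStronglyBounded A) (hB : IsStronglyBounded B) :
    IsStronglyBounded (A * B) := fun ℓ hℓ => by
  obtain ⟨a, ha⟩ := hA ℓ hℓ
  obtain ⟨b, hb⟩ := hB ℓ hℓ
  refine ⟨a + b, ?_⟩
  rintro _ ⟨g, hg, h, hh, rfl⟩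
  exact (hℓ.mul_le g h).trans (add_le_add (ha g hg) (hb h hh))

theorem inv (hA : IsStronglyBounded A) : IsStronglyBounded A⁻¹ := fun ℓ hℓ =>
  (hA ℓ hℓ).imp fun _ ha g hg => by simpa using (hℓ.inv_le g⁻¹).trans (ha _ hg)

theorem image (hA : IsStronglyBounded A) (φ : G →* H) : IsStronglyBounded (φ '' A) :=
  fun _ hℓ => (hA _ (hℓ.comp φ)).imp fun _ ha => forall_mem_image.2 ha

theorem comap_of_le_range {Γ : Subgroup H} (hΓ : IsStronglyBounded (univ : Set Γ)) {J : G →* H}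
    (hJ : Function.Injective J) (hle : Γ ≤ J.range) :
    IsStronglyBounded (Γ.comap J : Set G) := by
  refine (hΓ.image ((MonoidHom.ofInjective hJ).symm.toMonoidHom.comp
    (Subgroup.inclusion hle))).mono fun g hg => ⟨⟨J g, hg⟩, mem_univ _, ?_⟩
  exact (MonoidHom.ofInjective hJ).symm_apply_apply g

theorem of_forall_seq_commutator (t : G) (s : ℕ → G)
    (h : ∀ a : ℕ → G, (∀ n, a n ∈ A) → ∃ F, ∀ n, a n = ⁅(s n)⁻¹ * F * s n, t⁆) :
    IsStronglyBounded A := by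
  intro ℓ hℓ
  by_contra! hunbounded
  choose a haA ha using fun n => hunbounded (2 * (n + 2 * ℓ (s n)) + 2 * ℓ t)
  obtain ⟨F, hF⟩ := h a haA
  have hconj := hℓ.mul_le ((s (ℓ F))⁻¹ * F) (s (ℓ F))
  have hleft := hℓ.mul_le (s (ℓ F))⁻¹ F
  have hinv := hℓ.inv_le (s (ℓ F))
  have hcomm := hℓ.commutatorElement_le ((s (ℓ F))⁻¹ * F * s (ℓ F)) t
  have hlarge := ha (ℓ F)
  rw [hF (ℓ F)] at hlarge
  omega

theorem exists_subset_of_filtration (hA : IsStronglyBounded A) {V : ℕ → Set G} (hmono : Monotone V)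
    (hinv : ∀ n, (V n)⁻¹ = V n) (hmul : ∀ n, V n * V n ⊆ V (n + 1)) (hV : ⋃ n, V n = univ) :
    ∃ n, A ⊆ V n := by
  classical
  have hex : ∀ g, ∃ n, g ∈ V n := iUnion_eq_univ_iff.1 hV
  obtain ⟨n, hn⟩ := hA (fun g => Nat.find (hex g) + 1)
    { mul_le g h := by
        have hg := hmono (le_max_left (Nat.find (hex g)) (Nat.find (hex h))) (Nat.find_spec (hex g))
        have hh := hmono (le_max_right (Nat.find (hex g)) (Nat.find (hex h)))
          (Nat.find_spec (hex h))
        have := Nat.find_min' (hex (g * h)) (hmul _ (mul_mem_mul hg hh))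
        omega
      inv_le g := by
        have := Nat.find_min' (hex g⁻¹)
          (by rw [← hinv]; exact inv_mem_inv.2 (Nat.find_spec (hex g)))
        omega }
  exact ⟨n, fun g hg => hmono (Nat.le_of_succ_le (hn g hg)) (Nat.find_spec (hex g))⟩

theorem isBergman (hG : IsStronglyBounded (univ : Set G)) : IsBergman G := by
  intro W hW hWG
  have hex : ∀ g : G, ∃ n, g ∈ W n := iUnion_eq_univ_iff.1 hWG
  obtain ⟨N, hN⟩ := hex 1
  let U : ℕ → Set G := fun n => W (N + n) ∩ (W (N + n))⁻¹
  have hWN : Monotone fun n => W (N + n) := fun m n hmn => hW (Nat.add_le_add_left hmn N)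
  have hone : ∀ n, (1 : G) ∈ U n := fun n =>
    ⟨hWN n.zero_le hN, by simpa using hWN n.zero_le hN⟩
  have hU : Monotone U := hWN.inter fun m n hmn => inv_subset_inv.2 (hWN hmn)
  have hUinv : ∀ n, (U n)⁻¹ = U n := fun n => by
    simp only [U, inter_inv, inv_inv, inter_comm]
  obtain ⟨n, hn⟩ := hG.exists_subset_of_filtration (V := fun n => U n ^ 2 ^ n)
    (monotone_nat_of_le_succ fun n => (pow_subset_pow_left (hU n.le_succ)).trans
      (Set.pow_right_monotone (hone _) (Nat.pow_le_pow_right two_pos n.le_succ)))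
    (fun n => by rw [← inv_pow, hUinv])
    (fun n => by
      rw [← pow_add, ← mul_two, ← pow_succ]
      exact pow_subset_pow_left (hU n.le_succ))
    (iUnion_eq_univ_iff.2 fun g => by
      obtain ⟨m, hm⟩ := hex g
      obtain ⟨k, hk⟩ := hex g⁻¹
      exact ⟨m + k, subset_pow (hone _) (by positivity) ⟨hW (by omega) hm, hW (by omega) hk⟩⟩)
  exact ⟨N + n, 2 ^ n, univ_subset_iff.1 (hn.trans (pow_subset_pow_left inter_subset_left))⟩

end IsStronglyBounded

end StronglyBounded

section FixingSubgroup

variable {G X : Type*} [Group G] [MulAction G X]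

theorem smul_mem_iff_of_mem_fixingSubgroup_compl {J : Set X} {g : G}
    (hg : g ∈ fixingSubgroup G Jᶜ) (x : X) : g • x ∈ J ↔ x ∈ J := by
  rw [mem_fixingSubgroup_iff] at hg
  refine not_iff_not.1 ⟨fun h => ?_, fun h => ?_⟩
  · rwa [← smul_left_cancel g (hg _ h)]
  · rwa [hg x h]

theorem commute_of_mem_fixingSubgroup_compl [FaithfulSMul G X] {J : Set X} {g h : G}
    (hg : g ∈ fixingSubgroup G J) (hh : h ∈ fixingSubgroup G Jᶜ) : Commute g h := by
  refine FaithfulSMul.eq_of_smul_eq_smul (α := X) fun x => ?_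
  have hJ := smul_mem_iff_of_mem_fixingSubgroup_compl hh x
  have hJc := smul_mem_iff_of_mem_fixingSubgroup_compl (J := Jᶜ) (by rwa [compl_compl]) x
  rw [mem_fixingSubgroup_iff] at hg hh
  rw [mul_smul, mul_smul]
  by_cases hx : x ∈ J
  · rw [hg x hx, hg _ (hJ.2 hx)]
  · rw [hh x hx, hh _ (hJc.2 hx)]

theorem commutatorElement_congr_left [FaithfulSMul G X] {J : Set X} {g h t : G}
    (ht : t ∈ fixingSubgroup G Jᶜ) (hgh : ∀ x ∈ J, g • x = h • x) : ⁅g, t⁆ = ⁅h, t⁆ := by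
  have hfix : h⁻¹ * g ∈ fixingSubgroup G J := by
    refine (mem_fixingSubgroup_iff G).2 fun x hx => ?_
    rw [mul_smul, hgh x hx, inv_smul_smul]
  have hcomm := (commute_of_mem_fixingSubgroup_compl hfix ht).eq
  calc ⁅g, t⁆ = h * (h⁻¹ * g * t) * g⁻¹ * t⁻¹ := by rw [commutatorElement_def]; group
    _ = ⁅h, t⁆ := by rw [hcomm, commutatorElement_def]; group

theorem IsStronglyBounded.fixingSubgroup_of_smul_mem {A B : Set X}
    (hA : IsStronglyBounded (fixingSubgroup G A : Set G)) (g : G) (h : ∀ x ∈ A, g • x ∈ B) :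
    IsStronglyBounded (fixingSubgroup G B : Set G) := by
  refine (hA.image (MulAut.conj g).toMonoidHom).mono fun b hb => ⟨g⁻¹ * b * g, ?_, ?_⟩
  · refine (mem_fixingSubgroup_iff G).2 fun x hx => ?_
    rw [mul_smul, mul_smul, (mem_fixingSubgroup_iff G).1 hb _ (h x hx), inv_smul_smul]
  · simp [mul_assoc]

end FixingSubgroup

section Gluing

variable {L ι : Type*} [LinearOrder L]

theorem lt_of_disjoint_of_ordConnected {A B : Set L} (hAB : Disjoint A B) (hA : A.OrdConnected)
    (hB : B.OrdConnected) {x x' y y' : L} (hx : x ∈ A) (hx' : x' ∈ A) (hy : y ∈ B) (hy' : y' ∈ B)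
    (h : x < y) : x' < y' := by
  rw [disjoint_left] at hAB
  have hyx' : ∀ z ∈ B, z ≤ x' → False := fun z hz hzx' => by
    rcases le_total x z with hxz | hzx
    · exact hAB (hA.out hx hx' ⟨hxz, hzx'⟩) hz
    · exact hAB hx (hB.out hz hy ⟨hzx, h.le⟩)
  exact lt_of_not_ge (hyx' y' hy')

/-- The order automorphism that agrees with `f i` on the fibre `π ⁻¹' {i}`, for a partition of a
linear order into convex pieces each of which is preserved by its own `f i`. -/
def glue (π : L → ι) (hπ : ∀ i, (π ⁻¹' {i}).OrdConnected) (f : ι → L ≃o L)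
    (hf : ∀ i x, π (f i x) = i ↔ π x = i) : L ≃o L :=
  StrictMono.orderIsoOfRightInverse (fun x => f (π x) x)
    (fun x y hxy => by
      by_cases h : π x = π y
      · simpa only [h] using (f (π y)).strictMono hxy
      · exact lt_of_disjoint_of_ordConnected
          ((disjoint_singleton.2 h).preimage π) (hπ _) (hπ _) rfl ((hf _ _).2 rfl) rfl
          ((hf _ _).2 rfl) hxy)
    (fun x => (f (π x)).symm x)
    (fun x => by
      have h : π ((f (π x)).symm x) = π x := (hf _ _).1 (by simp)
      simp only [h, OrderIso.apply_symm_apply])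

theorem exists_eqOn_of_disjoint {S : ι → Set L} (hS : ∀ i, (S i).OrdConnected)
    (hdisj : Pairwise (Disjoint on S)) (f : ι → L ≃o L) (hf : ∀ i x, f i x ∈ S i ↔ x ∈ S i) :
    ∃ F : L ≃o L, (∀ i, EqOn F (f i) (S i)) ∧ ∀ x, (∀ i, x ∉ S i) → F x = x := by
  classical
  let π : L → ι ⊕ L := fun x => if h : ∃ i, x ∈ S i then .inl h.choose else .inr x
  have hπ : ∀ i x, π x = .inl i ↔ x ∈ S i := fun i x => by
    refine ⟨fun h => ?_, fun hx => ?_⟩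
    · by_cases hx : ∃ i, x ∈ S i
      · simp only [π, dif_pos hx, Sum.inl.injEq] at h
        exact h ▸ hx.choose_spec
      · simp [π, dif_neg hx] at h
    · have hex : ∃ i, x ∈ S i := ⟨i, hx⟩
      simp only [π, dif_pos hex, Sum.inl.injEq]
      by_contra hne
      exact disjoint_left.1 (hdisj hne) hex.choose_spec hx
  have hπ_eq : ∀ x y, π x = .inr y → x = y := fun x y h => by
    by_cases hx : ∃ i, x ∈ S i <;> simp_all [π]
  refine ⟨glue π ?_ (Sum.elim f fun _ => 1) ?_, fun i x hx => ?_, fun x hx => ?_⟩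
  · rintro (i | y)
    · rw [show π ⁻¹' {.inl i} = S i from ext (hπ i)]
      exact hS i
    · have hsub : π ⁻¹' {.inr y} ⊆ {y} := fun x => hπ_eq x y
      rcases subset_singleton_iff_eq.1 hsub with h | h <;> rw [h]
      exacts [ordConnected_empty, ordConnected_singleton]
  · rintro (i | y) x
    · simp [hπ, hf]
    · rfl
  · change Sum.elim f _ (π x) x = f i x
    rw [(hπ i x).2 hx, Sum.elim_inl]
  · change Sum.elim f _ (π x) x = x
    rw [show π x = .inr x from dif_neg (not_exists.2 hx), Sum.elim_inr, RelIso.one_apply]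

theorem exists_mem_fixingSubgroup_compl_eqOn {S : Set L} (hS : S.OrdConnected) (f : L ≃o L)
    (hf : ∀ x, f x ∈ S ↔ x ∈ S) : ∃ F ∈ fixingSubgroup (L ≃o L) Sᶜ, EqOn F f S := by
  obtain ⟨F, hF, hF_fix⟩ := exists_eqOn_of_disjoint (fun _ : Unit => hS) Subsingleton.pairwise
    (fun _ => f) fun _ => hf
  exact ⟨F, (mem_fixingSubgroup_iff _).2 fun x hx => hF_fix x fun _ => hx, hF ()⟩

end Gluing

section Displacement

variable {L ι : Type*} [LinearOrder L] {I J : Set L} {t : L ≃o L}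

theorem ordConnected_smul (hJ : J.OrdConnected) (g : L ≃o L) : (g • J).OrdConnected := by
  rw [← inv_inv g, ← preimage_smul]
  exact hJ.preimage_mono (g⁻¹ : L ≃o L).monotone

theorem exists_forall_smul_smul_eq (hJ : J.OrdConnected) {s : ι → L ≃o L}
    (hs : Pairwise (Disjoint on fun i => s i • J)) {a : ι → L ≃o L}
    (ha : ∀ i, a i ∈ fixingSubgroup (L ≃o L) Jᶜ) :
    ∃ F : L ≃o L, (∀ i, ∀ x ∈ J, F • s i • x = s i • a i • x) ∧
      ∀ x, (∀ i, x ∉ s i • J) → F • x = x := by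
  obtain ⟨F, hF, hF_fix⟩ := exists_eqOn_of_disjoint (fun i => ordConnected_smul hJ (s i)) hs
    (fun i => s i * a i * (s i)⁻¹) fun i x => by
      rw [← RelIso.smul_def, mem_smul_set_iff_inv_smul_mem, mem_smul_set_iff_inv_smul_mem,
        ← smul_mem_iff_of_mem_fixingSubgroup_compl (ha i) ((s i)⁻¹ • x), smul_smul, smul_smul,
        mul_assoc, inv_mul_cancel_left]
  refine ⟨F, fun i x hx => ?_, hF_fix⟩
  rw [RelIso.smul_def, hF i (smul_mem_smul_set hx), ← RelIso.smul_def, mul_smul, mul_smul,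
    inv_smul_smul]

theorem eq_mul_conj_of_smul_pow_smul_eq (hdisj : Pairwise (Disjoint on fun n : ℕ => t ^ n • I))
    {h a : L ≃o L} (hh : h ∈ fixingSubgroup (L ≃o L) Iᶜ)
    (ha : ∀ n : ℕ, ∀ x ∈ I, a • t ^ n • x = t ^ n • h • x)
    (ha_fix : ∀ x, (∀ n : ℕ, x ∉ t ^ n • I) → a • x = x) : a = h * (t * a * t⁻¹) := by
  have ht_mem : ∀ {n x}, t⁻¹ • x ∈ t ^ n • I ↔ x ∈ t ^ (n + 1) • I := fun {n x} => by
    rw [← smul_mem_smul_set_iff (a := t), smul_inv_smul, smul_smul, ← pow_succ']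
  have hI_succ : ∀ n, ∀ x ∈ t ^ (n + 1) • I, x ∉ I := fun n x hx hxI =>
    disjoint_left.1 (hdisj n.succ_ne_zero) hx (by simpa using hxI)
  have hh_fix : ∀ x ∉ I, h • x = x := fun x hx => (mem_fixingSubgroup_iff _).1 hh x hx
  refine FaithfulSMul.eq_of_smul_eq_smul (α := L) fun x => ?_
  simp only [mul_smul]
  by_cases hx : ∃ n : ℕ, x ∈ t ^ n • I
  · obtain ⟨_ | n, y, hy, rfl⟩ := hx
    · have hy_fix := ha_fix (t⁻¹ • y) fun n hn => hI_succ n y (ht_mem.1 hn) hy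
      simpa only [pow_zero, one_smul, hy_fix, smul_inv_smul] using ha 0 y hy
    · have hhy := (smul_mem_iff_of_mem_fixingSubgroup_compl hh y).2 hy
      dsimp only
      rw [ha (n + 1) y hy, pow_succ', mul_smul, mul_smul, inv_smul_smul, ha n y hy, smul_smul t,
        ← pow_succ', hh_fix _ (hI_succ n _ (smul_mem_smul_set hhy))]
  · push Not at hx
    rw [ha_fix _ fun n hn => hx _ (ht_mem.1 hn), smul_inv_smul, ha_fix x hx,
      hh_fix x (by simpa using hx 0)]

theorem exists_eq_commutatorElement (hI : I.OrdConnected) (hIJ : I ⊆ J)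
    (ht : t ∈ fixingSubgroup (L ≃o L) Jᶜ) (hdisj : Pairwise (Disjoint on fun n : ℕ => t ^ n • I))
    {h : L ≃o L} (hh : h ∈ fixingSubgroup (L ≃o L) Iᶜ) :
    ∃ a ∈ fixingSubgroup (L ≃o L) Jᶜ, h = ⁅a, t⁆ := by
  -- `a` is the infinite product of the `t ^ n * h * t ^ (-n)`, whence `a = h * (t * a * t⁻¹)`.
  obtain ⟨a, ha, ha_fix⟩ := exists_forall_smul_smul_eq hI hdisj (a := fun _ => h) fun _ => hh
  have haJ : a ∈ fixingSubgroup (L ≃o L) Jᶜ := by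
    refine (mem_fixingSubgroup_iff _).2 fun x hx => ha_fix x fun n hn => hx ?_
    rw [mem_smul_set_iff_inv_smul_mem] at hn
    exact (smul_mem_iff_of_mem_fixingSubgroup_compl (inv_mem (pow_mem ht n)) x).1 (hIJ hn)
  have hshift := eq_mul_conj_of_smul_pow_smul_eq hdisj hh ha ha_fix
  refine ⟨a, haJ, ?_⟩
  calc h = h * (t * a * t⁻¹) * (t * a * t⁻¹)⁻¹ := by group
    _ = ⁅a, t⁆ := by rw [← hshift, commutatorElement_def]; group

theorem isStronglyBounded_fixingSubgroup_compl (hI : I.OrdConnected) (hJ : J.OrdConnected)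
    (hIJ : I ⊆ J) (ht : t ∈ fixingSubgroup (L ≃o L) Jᶜ)
    (hdisj : Pairwise (Disjoint on fun n : ℕ => t ^ n • I)) {s : ℕ → L ≃o L}
    (hs : Pairwise (Disjoint on fun n => s n • J)) :
    IsStronglyBounded (fixingSubgroup (L ≃o L) Iᶜ : Set (L ≃o L)) := by
  refine .of_forall_seq_commutator t s fun h hh => ?_
  choose a haJ ha using fun n => exists_eq_commutatorElement hI hIJ ht hdisj (hh n)
  obtain ⟨F, hF, -⟩ := exists_forall_smul_smul_eq hJ hs haJ
  refine ⟨F, fun n => (ha n).trans (commutatorElement_congr_left ht fun x hx => ?_)⟩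
  rw [mul_smul, mul_smul, hF n x hx, inv_smul_smul]

theorem pairwise_disjoint_pow_smul_Ioo {a : L} (ha : a ≤ t a) :
    Pairwise (Disjoint on fun n : ℕ => t ^ n • Ioo a (t a)) := by
  have hsucc : ∀ n : ℕ, t ^ n • Ioo a (t a) = Ioo ((t ^ n) a) ((t ^ (n + 1)) a) := fun n => by
    rw [pow_succ, RelIso.mul_apply]
    exact (t ^ n).image_Ioo a (t a)
  simp only [hsucc]
  refine Monotone.pairwise_disjoint_on_Ioo_succ (f := fun n => (t ^ n) a)
    (monotone_nat_of_le_succ fun n => ?_)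
  rw [pow_succ]
  exact (t ^ n).monotone ha

end Displacement

section OrderedField

variable {K : Type*} [Field K] [LinearOrder K] [IsStrictOrderedRing K] {a b c d : K}

theorem exists_mem_fixingSubgroup_Iic_apply_eq (hb : a < b) (hc : a < c) :
    ∃ f ∈ fixingSubgroup (K ≃o K) (Iic a), f b = c := by
  have hslope : 0 < (c - a) / (b - a) := div_pos (sub_pos.2 hc) (sub_pos.2 hb)
  let affine : K ≃o K :=
    ((OrderIso.subRight a).trans (OrderIso.mulLeft₀ _ hslope)).trans (OrderIso.addRight a)
  have haffine : ∀ x, affine x = (c - a) / (b - a) * (x - a) + a := fun _ => rfl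
  obtain ⟨f, hf, hf_eq⟩ := exists_mem_fixingSubgroup_compl_eqOn ordConnected_Ioi affine
    fun x => show affine x ∈ Ioi a ↔ x ∈ Ioi a by
      rw [haffine, mem_Ioi, mem_Ioi, lt_add_iff_pos_left, mul_pos_iff_of_pos_left hslope, sub_pos]
  refine ⟨f, by rwa [compl_Ioi] at hf, ?_⟩
  rw [hf_eq hb, haffine, div_mul_cancel₀ _ (sub_pos.2 hb).ne', sub_add_cancel]

theorem exists_mem_fixingSubgroup_compl_Ioo_apply_eq (hb : b ∈ Ioo a d) (hc : c ∈ Ioo a d) :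
    ∃ f ∈ fixingSubgroup (K ≃o K) (Ioo a d)ᶜ, f b = c := by
  obtain ⟨g, hg, hgb⟩ := exists_mem_fixingSubgroup_Iic_apply_eq hb.1 hc.1
  obtain ⟨k, hk, hkd⟩ := exists_mem_fixingSubgroup_Iic_apply_eq
    (hgb ▸ g.strictMono hb.2 : c < g d) hc.2
  have hk_fix : ∀ x ≤ c, k x = x := (mem_fixingSubgroup_iff _).1 hk
  have hga : g a = a := (mem_fixingSubgroup_iff _).1 hg a le_rfl
  have hkga : (k * g) a = a := by rw [RelIso.mul_apply, hga, hk_fix a hc.1.le]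
  obtain ⟨f, hf, hf_eq⟩ := exists_mem_fixingSubgroup_compl_eqOn (S := Ioo a d) ordConnected_Ioo
    (k * g) fun x => by
      rw [mem_Ioo, mem_Ioo, ← (k * g).lt_iff_lt (x := a) (y := x),
        ← (k * g).lt_iff_lt (x := x) (y := d), hkga, RelIso.mul_apply k g d, hkd]
  refine ⟨f, hf, ?_⟩
  rw [hf_eq hb, RelIso.mul_apply, hgb, hk_fix c le_rfl]

theorem isStronglyBounded_fixingSubgroup_compl_Ioo (hab : a < b) :
    IsStronglyBounded (fixingSubgroup (K ≃o K) (Ioo a b)ᶜ : Set (K ≃o K)) := by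
  obtain ⟨t, ht, rfl⟩ := exists_mem_fixingSubgroup_compl_Ioo_apply_eq
    (a := a - 1) (d := b + 1) (b := a) (c := b) (by constructor <;> linarith)
    (by constructor <;> linarith)
  let left : ℕ → K := fun n => a - 1 + n * (t a - a + 2)
  have hleft : Monotone left :=
    monotone_const.add (Nat.mono_cast.mul_const (by linarith))
  refine isStronglyBounded_fixingSubgroup_compl (J := Ioo (a - 1) (t a + 1)) ordConnected_Ioo
    ordConnected_Ioo (Ioo_subset_Ioo (by linarith) (by linarith)) ht
    (pairwise_disjoint_pow_smul_Ioo hab.le)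
    (s := fun n => OrderIso.addRight (n * (t a - a + 2))) ?_
  convert hleft.pairwise_disjoint_on_Ioo_succ using 3 with n
  change (OrderIso.addRight _) '' _ = _
  rw [OrderIso.image_Ioo]
  simp only [left, OrderIso.addRight_apply, Order.succ_eq_add_one]
  push_cast
  ring_nf

end OrderedField

section CircularAut

variable {L : Type*} [LinearOrder L]

/-- The automorphism group of a circular order. The circles studied below are the one-point
completions `WithTop L` of linear orders, with the circular order `LT.toSBtw` coming from the linear
order of `WithTop L`. -/
def circularAut (X : Type*) [SBtw X] : Subgroup (Equiv.Perm X) where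
  carrier := {g | ∀ x y z, sbtw (g x) (g y) (g z) ↔ sbtw x y z}
  one_mem' _ _ _ := Iff.rfl
  mul_mem' hg hh x y z := (hg _ _ _).trans (hh x y z)
  inv_mem' {g} hg x y z := by simpa using (hg (g⁻¹ x) (g⁻¹ y) (g⁻¹ z)).symm

attribute [local instance] LT.toSBtw

theorem mem_circularAut_of_swap_cut {g : Equiv.Perm L} (c : L)
    (hg : ∀ x y, g x < g y ↔ (x ≤ c ∧ y ≤ c ∧ x < y) ∨ (c < x ∧ c < y ∧ x < y) ∨ (c < x ∧ y ≤ c)) :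
    g ∈ circularAut L := by
  intro x y z
  simp only [sbtw, hg]
  grind

/-- An order automorphism of `L`, extended to the circle `WithTop L` by fixing `⊤`. -/
def ofOrderIso : (L ≃o L) →* circularAut (WithTop L) where
  toFun f := ⟨f.withTopCongr.toEquiv, fun x y z => by
    simp only [sbtw, OrderIso.coe_toEquiv, OrderIso.lt_iff_lt]⟩
  map_one' := Subtype.ext <| Equiv.ext fun x => by cases x <;> rfl
  map_mul' f g := Subtype.ext <| Equiv.ext fun x => by cases x <;> rfl

theorem exists_ofOrderIso_eq {g : circularAut (WithTop L)} (hg : g • (⊤ : WithTop L) = ⊤) :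
    ∃ f, ofOrderIso f = g := by
  have hne : ∀ x : L, ∃ y : L, (y : WithTop L) = g • (x : WithTop L) := fun x => by
    rw [← WithTop.ne_top_iff_exists, ← hg]
    exact fun h => WithTop.coe_ne_top (smul_left_cancel g h)
  choose k hk using hne
  have hmono : StrictMono k := fun x y hxy => by
    have h := (g.2 x y ⊤).2 (.inl ⟨WithTop.coe_lt_coe.2 hxy, WithTop.coe_lt_top y⟩)
    change sbtw (g • (x : WithTop L)) (g • (y : WithTop L)) (g • (⊤ : WithTop L)) at h
    rw [hg, ← hk, ← hk] at h
    simpa [sbtw] using h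
  have hsurj : Function.Surjective k := fun y => by
    have hy : g⁻¹ • (y : WithTop L) ≠ ⊤ := by
      rw [ne_eq, inv_smul_eq_iff, hg]
      exact WithTop.coe_ne_top
    obtain ⟨x, hx⟩ := WithTop.ne_top_iff_exists.1 hy
    exact ⟨x, WithTop.coe_injective (by rw [hk, hx, smul_inv_smul])⟩
  refine ⟨hmono.orderIsoOfSurjective k hsurj, FaithfulSMul.eq_of_smul_eq_smul (α := WithTop L) ?_⟩
  rintro (_ | x)
  · exact hg.symm
  · exact hk x

theorem ofOrderIso_image_fixingSubgroup (S : Set L) :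
    ofOrderIso '' (fixingSubgroup (L ≃o L) S : Set (L ≃o L)) =
      (fixingSubgroup (circularAut (WithTop L)) (insert ⊤ (WithTop.some '' S)) :
        Set (circularAut (WithTop L))) := by
  ext g
  simp only [SetLike.mem_coe, mem_fixingSubgroup_iff, forall_mem_insert, forall_mem_image]
  refine ⟨?_, fun ⟨htop, hS⟩ => ?_⟩
  · rintro ⟨f, hf, rfl⟩
    exact ⟨rfl, fun x hx => congrArg WithTop.some ((mem_fixingSubgroup_iff _).1 hf x hx)⟩
  · obtain ⟨f, rfl⟩ := exists_ofOrderIso_eq htop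
    exact ⟨f, (mem_fixingSubgroup_iff _).2 fun x hx => WithTop.coe_injective (hS hx), rfl⟩

theorem IsStronglyBounded.ofOrderIso_image_of_smul_mem {A B : Set L}
    (hA : IsStronglyBounded (ofOrderIso '' (fixingSubgroup (L ≃o L) A : Set (L ≃o L))))
    (g : circularAut (WithTop L))
    (h : ∀ x ∈ insert ⊤ (WithTop.some '' A), g • x ∈ insert ⊤ (WithTop.some '' B)) :
    IsStronglyBounded (ofOrderIso '' (fixingSubgroup (L ≃o L) B : Set (L ≃o L))) := by
  rw [ofOrderIso_image_fixingSubgroup] at hA ⊢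
  exact hA.fixingSubgroup_of_smul_mem g h

end CircularAut

section Inversion

variable {K : Type*} [Field K] [LinearOrder K]

attribute [local instance] LT.toSBtw

/-- The map `x ↦ -x⁻¹` of the projective line `WithTop K`, which exchanges `0` and `⊤`. -/
def negInv : Equiv.Perm (WithTop K) :=
  Function.Involutive.toPerm
    (WithTop.recTopCoe 0 fun a => if a = 0 then ⊤ else WithTop.some (-a⁻¹)) fun x => by
      cases x with
      | top => exact if_pos rfl
      | coe a =>
        rcases eq_or_ne a 0 with rfl | ha
        · simp only [WithTop.recTopCoe_coe, if_true, WithTop.recTopCoe_top]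
          rfl
        · simp only [WithTop.recTopCoe_coe, if_neg ha, if_neg (neg_ne_zero.2 (inv_ne_zero ha)),
            inv_neg, inv_inv, neg_neg]

theorem negInv_top : negInv (⊤ : WithTop K) = 0 := rfl

theorem negInv_zero : negInv (0 : WithTop K) = ⊤ := if_pos rfl

theorem negInv_coe {a : K} (ha : a ≠ 0) : negInv (a : WithTop K) = WithTop.some (-a⁻¹) :=
  if_neg ha

variable [IsStrictOrderedRing K]

theorem negInv_pos_iff (x : WithTop K) : 0 < negInv x ↔ x ≤ 0 := by
  cases x with
  | top => simp [negInv_top]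
  | coe a =>
    rcases eq_or_ne a 0 with rfl | ha
    · simp [negInv_zero]
    · rw [negInv_coe ha]
      norm_cast
      rw [Left.neg_pos_iff, inv_lt_zero, le_iff_lt_or_eq, or_iff_left ha]

theorem negInv_strictMonoOn_Iic : StrictMonoOn negInv (Iic (0 : WithTop K)) := by
  intro x hx y hy hxy
  lift x to K using hxy.ne_top
  lift y to K using ne_top_of_le_ne_top WithTop.zero_ne_top hy
  have hx0 : x < 0 := by exact_mod_cast hxy.trans_le hy
  rw [negInv_coe hx0.ne]
  rcases eq_or_ne y 0 with rfl | hy0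
  · exact negInv_zero (K := K) ▸ WithTop.coe_lt_top _
  · have hy0 : y < 0 := lt_of_le_of_ne (by exact_mod_cast mem_Iic.1 hy) hy0
    rw [negInv_coe hy0.ne, WithTop.coe_lt_coe, neg_lt_neg_iff, inv_lt_inv_of_neg hy0 hx0]
    exact_mod_cast hxy

theorem negInv_strictMonoOn_Ioi : StrictMonoOn negInv (Ioi (0 : WithTop K)) := by
  intro x hx y hy hxy
  lift x to K using hxy.ne_top
  have hx0 : 0 < x := by exact_mod_cast mem_Ioi.1 hx
  rw [negInv_coe hx0.ne']
  cases y with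
  | top =>
    rw [negInv_top, ← WithTop.coe_zero, WithTop.coe_lt_coe, neg_lt_zero]
    exact inv_pos.2 hx0
  | coe y =>
    have hxy : x < y := by exact_mod_cast hxy
    rw [negInv_coe (hx0.trans hxy).ne', WithTop.coe_lt_coe, neg_lt_neg_iff,
      inv_lt_inv₀ (hx0.trans hxy) hx0]
    exact hxy

theorem negInv_mem_circularAut : (negInv : Equiv.Perm (WithTop K)) ∈ circularAut (WithTop K) := by
  refine mem_circularAut_of_swap_cut 0 fun x y => ?_
  have hx_pos := negInv_pos_iff x
  have hy_pos := negInv_pos_iff y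
  rcases le_or_gt x 0 with hx | hx <;> rcases le_or_gt y 0 with hy | hy
  · have := negInv_strictMonoOn_Iic.lt_iff_lt hx hy
    grind
  · grind
  · grind
  · have := negInv_strictMonoOn_Ioi.lt_iff_lt (mem_Ioi.2 hx) (mem_Ioi.2 hy)
    grind

/-- `negInv` as an automorphism of the circle `WithTop K`. -/
def negInvAut : circularAut (WithTop K) :=
  ⟨negInv, negInv_mem_circularAut⟩

theorem negInvAut_smul (x : WithTop K) : negInvAut (K := K) • x = negInv x := rfl

theorem ofOrderIso_addRight_mul_negInvAut_smul_top (c : K) :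
    (ofOrderIso (OrderIso.addRight c) * negInvAut) • (⊤ : WithTop K) = c := by
  rw [mul_smul, negInvAut_smul, negInv_top]
  exact congrArg WithTop.some (zero_add c)

theorem exists_circularAut_smul_top_eq (x : WithTop K) :
    ∃ g : circularAut (WithTop K), g • (⊤ : WithTop K) = x := by
  cases x with
  | top => exact ⟨1, one_smul _ _⟩
  | coe c => exact ⟨_, ofOrderIso_addRight_mul_negInvAut_smul_top c⟩

theorem univ_eq_range_ofOrderIso_union :
    (univ : Set (circularAut (WithTop K))) =
      range ofOrderIso ∪ range ofOrderIso * {negInvAut} * range ofOrderIso := by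
  refine (eq_univ_of_forall fun g => ?_).symm
  cases hg : g • (⊤ : WithTop K) with
  | top => exact .inl (exists_ofOrderIso_eq hg)
  | coe c =>
    obtain ⟨f, hf⟩ := exists_ofOrderIso_eq
      (g := (ofOrderIso (OrderIso.addRight c) * negInvAut)⁻¹ * g) <| by
        rw [mul_smul, hg, inv_smul_eq_iff, ofOrderIso_addRight_mul_negInvAut_smul_top]
    exact .inr ⟨_, mul_mem_mul (mem_range_self _) rfl, _, ⟨f, hf⟩, mul_inv_cancel_left _ g⟩

end Inversion

section StronglyBoundedCircularAut

attribute [local instance] LT.toSBtw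

theorem fixingSubgroup_singleton_subset_mul {L : Type*} [LinearOrder L] (a : L) :
    (fixingSubgroup (L ≃o L) {a} : Set (L ≃o L)) ⊆
      fixingSubgroup (L ≃o L) (Ici a) * fixingSubgroup (L ≃o L) (Iic a) := by
  intro f hf
  have hfa : f a = a := (mem_fixingSubgroup_iff _).1 hf a rfl
  obtain ⟨g, hg, hgf⟩ := exists_mem_fixingSubgroup_compl_eqOn ordConnected_Iio f fun x => by
    rw [mem_Iio, mem_Iio, ← f.lt_iff_lt (x := x), hfa]
  rw [compl_Iio] at hg
  have hga : g a = a := (mem_fixingSubgroup_iff _).1 hg a le_rfl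
  refine ⟨g, hg, g⁻¹ * f, (mem_fixingSubgroup_iff _).2 fun x hx => ?_, mul_inv_cancel_left g f⟩
  rw [mul_smul, inv_smul_eq_iff]
  rcases (mem_Iic.1 hx).eq_or_lt with rfl | hx
  · exact hfa.trans hga.symm
  · exact (hgf hx).symm

variable {K : Type*} [Field K] [LinearOrder K] [IsStrictOrderedRing K]

theorem fixingSubgroup_mul_union_inv_eq_univ {a b : K} (hab : a < b) :
    (fixingSubgroup (K ≃o K) {a} * fixingSubgroup (K ≃o K) {b} : Set (K ≃o K)) ∪
      (fixingSubgroup (K ≃o K) {a} * fixingSubgroup (K ≃o K) {b} : Set (K ≃o K))⁻¹ = univ := by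
  have hmul : ∀ f : K ≃o K, a < f b →
      f ∈ (fixingSubgroup (K ≃o K) {a} * fixingSubgroup (K ≃o K) {b} : Set (K ≃o K)) := by
    intro f hf
    obtain ⟨g, hg, hgb⟩ := exists_mem_fixingSubgroup_Iic_apply_eq hab hf
    refine ⟨g, fixingSubgroup_antitone _ _ (singleton_subset_iff.2 (mem_Iic.2 le_rfl)) hg, g⁻¹ * f,
      (mem_fixingSubgroup_iff _).2 ?_, mul_inv_cancel_left g f⟩
    rintro _ rfl
    rw [mul_smul, inv_smul_eq_iff]
    exact hgb.symm
  refine eq_univ_of_forall fun f => ?_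
  rcases lt_or_ge a (f b) with h | h
  · exact .inl (hmul f h)
  · refine .inr (hmul f⁻¹ (hab.trans ?_))
    rw [← f.lt_iff_lt, RelIso.apply_inv_self]
    exact h.trans_lt hab

theorem IsStronglyBounded.ofOrderIso_image_translate {A B : Set K}
    (hA : IsStronglyBounded (ofOrderIso '' (fixingSubgroup (K ≃o K) A : Set (K ≃o K)))) (c : K)
    (h : ∀ x ∈ A, x + c ∈ B) :
    IsStronglyBounded (ofOrderIso '' (fixingSubgroup (K ≃o K) B : Set (K ≃o K))) := by
  refine hA.ofOrderIso_image_of_smul_mem (ofOrderIso (OrderIso.addRight c)) ?_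
  rw [forall_mem_insert, forall_mem_image]
  exact ⟨.inl rfl, fun x hx => .inr ⟨_, h x hx, rfl⟩⟩

theorem IsStronglyBounded.ofOrderIso_image_negInv {A B : Set K}
    (hA : IsStronglyBounded (ofOrderIso '' (fixingSubgroup (K ≃o K) A : Set (K ≃o K))))
    (hB : 0 ∈ B) (h : ∀ x ∈ A, x ≠ 0 → -x⁻¹ ∈ B) :
    IsStronglyBounded (ofOrderIso '' (fixingSubgroup (K ≃o K) B : Set (K ≃o K))) := by
  refine hA.ofOrderIso_image_of_smul_mem negInvAut ?_
  simp only [forall_mem_insert, forall_mem_image, negInvAut_smul]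
  refine ⟨.inr ⟨0, hB, rfl⟩, fun x hx => ?_⟩
  rcases eq_or_ne x 0 with rfl | hx0
  · exact .inl negInv_zero
  · exact .inr ⟨_, h x hx hx0, (negInv_coe hx0).symm⟩

theorem isStronglyBounded_ofOrderIso_image_fixingSubgroup_Ici :
    IsStronglyBounded (ofOrderIso '' (fixingSubgroup (K ≃o K) (Ici (0 : K)) : Set (K ≃o K))) := by
  have hunit := (isStronglyBounded_fixingSubgroup_compl_Ioo (zero_lt_one (α := K))).image ofOrderIso
  have hIci : IsStronglyBounded (ofOrderIso '' (fixingSubgroup (K ≃o K) (Ici (-1 : K)) :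
      Set (K ≃o K))) := by
    refine hunit.ofOrderIso_image_negInv (by simp) fun x hx hx0 => ?_
    rw [mem_Ici, neg_le_neg_iff]
    rcases lt_or_gt_of_ne hx0 with hneg | hpos
    · exact (inv_lt_zero.2 hneg).le.trans zero_le_one
    · exact inv_le_one_of_one_le₀ (not_lt.1 fun h => hx ⟨hpos, h⟩)
  exact hIci.ofOrderIso_image_translate 1 fun x hx => neg_le_iff_add_nonneg.1 hx

theorem isStronglyBounded_ofOrderIso_image_fixingSubgroup_singleton (a : K) :
    IsStronglyBounded (ofOrderIso '' (fixingSubgroup (K ≃o K) {a} : Set (K ≃o K))) := by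
  have hIci := isStronglyBounded_ofOrderIso_image_fixingSubgroup_Ici (K := K)
  have hIic : IsStronglyBounded (ofOrderIso '' (fixingSubgroup (K ≃o K) (Iic (0 : K)) :
      Set (K ≃o K))) :=
    hIci.ofOrderIso_image_negInv (mem_Iic.2 le_rfl) fun x hx _ =>
      neg_nonpos.2 (inv_nonneg.2 hx)
  have hzero : IsStronglyBounded (ofOrderIso '' (fixingSubgroup (K ≃o K) {(0 : K)} :
      Set (K ≃o K))) :=
    (hIci.mul hIic).mono (by
      rw [← image_mul]
      exact image_mono (fixingSubgroup_singleton_subset_mul 0))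
  exact hzero.ofOrderIso_image_translate a (by simp)

theorem isStronglyBounded_range_ofOrderIso :
    IsStronglyBounded (range (ofOrderIso (L := K))) := by
  have hmul := (isStronglyBounded_ofOrderIso_image_fixingSubgroup_singleton (0 : K)).mul
    (isStronglyBounded_ofOrderIso_image_fixingSubgroup_singleton 1)
  refine (hmul.union hmul.inv).mono ?_
  rw [← image_mul, ← image_inv, ← image_union, fixingSubgroup_mul_union_inv_eq_univ zero_lt_one,
    image_univ]

theorem isStronglyBounded_circularAut :
    IsStronglyBounded (univ : Set (circularAut (WithTop K))) := by
  have hrange := isStronglyBounded_range_ofOrderIso (K := K)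
  rw [univ_eq_range_ofOrderIso_union]
  exact hrange.union ((hrange.mul (.singleton _)).mul hrange)

end StronglyBoundedCircularAut

section CountableDense

theorem nonempty_orderIso_withTop_rat (α : Type*) [LinearOrder α] [OrderTop α] [NoMinOrder α]
    [DenselyOrdered α] [Countable α] : Nonempty (α ≃o WithTop ℚ) := by
  obtain ⟨x₀, hx₀⟩ := exists_lt (⊤ : α)
  have : Nonempty {x : α // x ≠ ⊤} := ⟨⟨x₀, hx₀.ne⟩⟩
  have : NoMaxOrder {x : α // x ≠ ⊤} := ⟨fun x => by
    obtain ⟨y, hxy, hy⟩ := exists_between (lt_top_iff_ne_top.2 x.2)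
    exact ⟨⟨y, hy.ne⟩, hxy⟩⟩
  have : NoMinOrder {x : α // x ≠ ⊤} := ⟨fun x => by
    obtain ⟨y, hy⟩ := exists_lt (x : α)
    exact ⟨⟨y, hy.ne_top⟩, hy⟩⟩
  have : DenselyOrdered {x : α // x ≠ ⊤} := ⟨fun x z hxz => by
    obtain ⟨y, hxy, hyz⟩ := exists_between (α := α) hxz
    exact ⟨⟨y, hyz.ne_top⟩, hxy, hyz⟩⟩
  obtain ⟨i⟩ := Order.iso_of_countable_dense {x : α // x ≠ ⊤} ℚ
  exact ⟨WithTop.subtypeOrderIso.symm.trans i.withTopCongr⟩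

theorem nonempty_orderIso_withTop_rat_of_dense {X : Type*} [LinearOrder X] [TopologicalSpace X]
    [OrderTopology X] [DenselyOrdered X] {S : Set X} (hS : Dense S) {a b : X} (hab : a < b)
    (hb : b ∈ S) [Countable {x : Ioc a b // (x : X) ∈ S}] :
    Nonempty ({x : Ioc a b // (x : X) ∈ S} ≃o WithTop ℚ) := by
  have hexists : ∀ x y, a ≤ x → x < y → y ≤ b →
      ∃ z : {x : Ioc a b // (x : X) ∈ S}, x < (z : X) ∧ (z : X) < y := fun x y hx hxy hy => by
    obtain ⟨z, hzS, hxz, hzy⟩ := hS.exists_between hxy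
    exact ⟨⟨⟨z, hx.trans_lt hxz, hzy.le.trans hy⟩, hzS⟩, hxz, hzy⟩
  let _ : OrderTop {x : Ioc a b // (x : X) ∈ S} :=
    { top := ⟨⟨b, hab, le_rfl⟩, hb⟩
      le_top := fun x => x.1.2.2 }
  have : NoMinOrder {x : Ioc a b // (x : X) ∈ S} := ⟨fun x => by
    obtain ⟨z, -, hzx⟩ := hexists a x le_rfl x.1.2.1 x.1.2.2
    exact ⟨z, hzx⟩⟩
  have : DenselyOrdered {x : Ioc a b // (x : X) ∈ S} := ⟨fun x y hxy =>
    hexists x y x.1.2.1.le hxy y.1.2.2⟩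
  exact nonempty_orderIso_withTop_rat _

end CountableDense

namespace CircleOrder

attribute [local instance] LT.toSBtw

theorem sbtw_coe_iff {a x y z : ℝ} (hx : x ∈ Ioc a (a + 1)) (hy : y ∈ Ioc a (a + 1))
    (hz : z ∈ Ioc a (a + 1)) :
    sbtw (x : UnitAddCircle) (y : UnitAddCircle) (z : UnitAddCircle) ↔ sbtw x y z := by
  -- Move `x` and `y` by a period into the interval of length `1` starting at `z`.
  have hico : ∀ u ∈ Ioc a (a + 1), toIcoMod zero_lt_one z u = if z ≤ u then u else u + 1 := by
    intro u hu
    split_ifs with h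
    · exact (toIcoMod_eq_self _).2 ⟨h, by linarith [hu.2, hz.1]⟩
    · rw [← toIcoMod_add_right]
      exact (toIcoMod_eq_self _).2 ⟨by linarith [hu.1, hz.2], by linarith⟩
  have hioc : ∀ u ∈ Ioc a (a + 1), toIocMod zero_lt_one z u = if z < u then u else u + 1 := by
    intro u hu
    split_ifs with h
    · exact (toIocMod_eq_self _).2 ⟨h, by linarith [hu.2, hz.1]⟩
    · rw [← toIocMod_add_right]
      exact (toIocMod_eq_self _).2 ⟨by linarith [hu.1, hz.2], by linarith⟩
  rw [sbtw_iff_not_btw, QuotientAddGroup.btw_coe_iff, hico y hy, hioc x hx]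
  obtain ⟨hx1, hx2⟩ := hx
  obtain ⟨hy1, hy2⟩ := hy
  simp only [sbtw]
  split_ifs <;> grind

theorem exists_equiv_withTop_rat {C : Set UnitAddCircle} (hC : C.Countable) (hd : Dense C) :
    ∃ e : C ≃ WithTop ℚ, ∀ x y z : C,
      sbtw (e x) (e y) (e z) ↔
        sbtw (x : UnitAddCircle) (y : UnitAddCircle) (z : UnitAddCircle) := by
  obtain ⟨c, hc⟩ := hd.nonempty
  obtain ⟨a, rfl⟩ := QuotientAddGroup.mk_surjective c
  have hmk : ∀ x, ((AddCircle.equivIoc 1 a x : ℝ) : UnitAddCircle) = x :=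
    (AddCircle.equivIoc 1 a).symm_apply_apply
  let u : C ≃ {r : Ioc a (a + 1) // (r : ℝ) ∈ ((↑) : ℝ → UnitAddCircle) ⁻¹' C} :=
    (AddCircle.equivIoc 1 a).subtypeEquiv fun x => by rw [mem_preimage, hmk]
  have : Countable C := hC.to_subtype
  have : Countable {r : Ioc a (a + 1) // (r : ℝ) ∈ ((↑) : ℝ → UnitAddCircle) ⁻¹' C} :=
    u.symm.injective.countable
  obtain ⟨i⟩ := nonempty_orderIso_withTop_rat_of_dense
    (hd.preimage QuotientAddGroup.isOpenMap_coe) (lt_add_one a)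
    (show ((a + 1 : ℝ) : UnitAddCircle) ∈ C by simpa using hc)
  refine ⟨u.trans i.toEquiv, fun x y z => ?_⟩
  rw [← hmk x, ← hmk y, ← hmk z, sbtw_coe_iff (Subtype.prop _) (Subtype.prop _) (Subtype.prop _)]
  simp only [sbtw, Equiv.trans_apply, OrderIso.coe_toEquiv, OrderIso.lt_iff_lt]
  rfl

theorem isBergman_aut {C : Set UnitAddCircle} (hC : C.Countable) (hd : Dense C) :
    IsBergman (aut C) := by
  obtain ⟨e, he⟩ := exists_equiv_withTop_rat hC hd
  have hmem : ∀ g : Equiv.Perm C, e.permCongrHom g ∈ circularAut (WithTop ℚ) ↔ g ∈ aut C := by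
    intro g
    have hge : ∀ x, e.permCongrHom g (e x) = e (g x) := fun x =>
      congrArg e (congrArg g (e.symm_apply_apply x))
    constructor
    · intro hg x y z
      have h := hg (e z) (e y) (e x)
      rwa [hge, hge, hge, he, he] at h
    · intro hg x y z
      obtain ⟨x, rfl⟩ := e.surjective x
      obtain ⟨y, rfl⟩ := e.surjective y
      obtain ⟨z, rfl⟩ := e.surjective z
      rw [hge, hge, hge, he, he]
      exact hg z y x
  let J : aut C →* Equiv.Perm (WithTop ℚ) := e.permCongrHom.toMonoidHom.comp (aut C).subtype
  have hbdd := (isStronglyBounded_circularAut (K := ℚ)).comap_of_le_range (J := J)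
    (e.permCongrHom.injective.comp (aut C).subtype_injective) fun g hg => by
      obtain ⟨g, rfl⟩ := e.permCongrHom.surjective g
      exact ⟨⟨g, (hmem g).1 hg⟩, rfl⟩
  exact (hbdd.mono fun g _ => (hmem g).2 g.2).isBergman

end CircleOrder

section Homeomorph

open OnePoint Filter Topology

attribute [local instance] LT.toSBtw

/-- The one-point compactification of `X` and `WithTop X` have the same points, `∞` being `⊤`. -/
def onePointEquivWithTop (X : Type*) : OnePoint X ≃ WithTop X where
  toFun := OnePoint.rec ⊤ WithTop.some
  invFun := WithTop.recTopCoe ∞ OnePoint.some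
  left_inv x := by cases x <;> rfl
  right_inv x := by cases x <;> rfl

/-- The action of the homeomorphisms of the one-point compactification of `X` on `WithTop X`. -/
def onePointPermHom (X : Type*) [TopologicalSpace X] :
    (OnePoint X ≃ₜ OnePoint X) →* Equiv.Perm (WithTop X) where
  toFun g := (onePointEquivWithTop X).permCongr g.toEquiv
  map_one' := (onePointEquivWithTop X).permCongr_refl
  map_mul' g h := (onePointEquivWithTop X).permCongrHom.map_mul g.toEquiv h.toEquiv

theorem onePointPermHom_injective (X : Type*) [TopologicalSpace X] :
    Function.Injective (onePointPermHom X) :=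
  (onePointEquivWithTop X).permCongr.injective.comp Homeomorph.toEquiv_injective

theorem tendsto_coe_cobounded_infty {X : Type*} [PseudoMetricSpace X] [ProperSpace X] :
    Tendsto ((↑) : X → OnePoint X) (Bornology.cobounded X) (𝓝 ∞) := by
  rw [Metric.cobounded_eq_cocompact, ← coclosedCompact_eq_cocompact]
  exact tendsto_coe_infty

/-- `negInv` on the one-point compactification of the line. -/
noncomputable def negInvOnePoint : Equiv.Perm (OnePoint ℝ) :=
  (onePointEquivWithTop ℝ).symm.permCongr negInv

theorem negInvOnePoint_coe {x : ℝ} (hx : x ≠ 0) :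
    negInvOnePoint (x : OnePoint ℝ) = ((-x⁻¹ : ℝ) : OnePoint ℝ) :=
  congrArg (onePointEquivWithTop ℝ).symm (negInv_coe hx)

theorem continuousAt_negInvOnePoint_infty : ContinuousAt negInvOnePoint (∞ : OnePoint ℝ) := by
  rw [continuousAt_infty', coclosedCompact_eq_cocompact, ← Metric.cobounded_eq_cocompact]
  have hinv : Tendsto (fun x : ℝ => -x⁻¹) (Bornology.cobounded ℝ) (𝓝 0) := by
    simpa only [neg_zero] using (tendsto_inv₀_cobounded (α := ℝ)).neg
  refine ((continuous_coe.tendsto (0 : ℝ)).comp hinv).congr' ?_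
  filter_upwards [Bornology.isBounded_def.1 (Bornology.isBounded_singleton (x := 0))] with x hx
  exact (negInvOnePoint_coe hx).symm

theorem continuousAt_negInvOnePoint_zero :
    ContinuousAt negInvOnePoint ((0 : ℝ) : OnePoint ℝ) := by
  rw [continuousAt_coe, continuousAt_iff_punctured_nhds]
  have hinv : Tendsto (fun x : ℝ => -x⁻¹) (𝓝[≠] 0) (Bornology.cobounded ℝ) :=
    tendsto_neg_cobounded.comp tendsto_inv₀_nhdsNE_zero
  rw [Function.comp_apply, show negInvOnePoint ((0 : ℝ) : OnePoint ℝ) = ∞ from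
    congrArg (onePointEquivWithTop ℝ).symm negInv_zero]
  refine (tendsto_coe_cobounded_infty.comp hinv).congr' ?_
  filter_upwards [self_mem_nhdsWithin] with x hx
  exact (negInvOnePoint_coe hx).symm

theorem continuous_negInvOnePoint : Continuous negInvOnePoint := by
  refine continuous_iff_continuousAt.2 fun z => ?_
  induction z with
  | infty => exact continuousAt_negInvOnePoint_infty
  | coe x =>
    rcases eq_or_ne x 0 with rfl | hx
    · exact continuousAt_negInvOnePoint_zero
    · rw [continuousAt_coe]
      refine (continuous_coe.continuousAt.comp (continuousAt_inv₀ hx).neg).congr ?_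
      filter_upwards [isOpen_ne.mem_nhds hx] with y hy
      exact (negInvOnePoint_coe hy).symm

theorem onePointPermHom_onePointCongr_toHomeomorph (f : ℝ ≃o ℝ) :
    onePointPermHom ℝ f.toHomeomorph.onePointCongr = ofOrderIso f :=
  Equiv.ext fun x => by cases x <;> rfl

theorem circularAut_le_range_onePointPermHom :
    circularAut (WithTop ℝ) ≤ (onePointPermHom ℝ).range := by
  have horder : ∀ f : ℝ ≃o ℝ, (ofOrderIso f : Equiv.Perm (WithTop ℝ)) ∈ (onePointPermHom ℝ).range :=
    fun f => ⟨_, onePointPermHom_onePointCongr_toHomeomorph f⟩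
  have hneg : negInv ∈ (onePointPermHom ℝ).range :=
    ⟨continuous_negInvOnePoint.homeoOfEquivCompactToT2,
      (onePointEquivWithTop ℝ).permCongr.apply_symm_apply negInv⟩
  suffices h : ∀ g : circularAut (WithTop ℝ), g.1 ∈ (onePointPermHom ℝ).range from
    fun g hg => h ⟨g, hg⟩
  intro g
  have hg := mem_univ g
  rw [univ_eq_range_ofOrderIso_union] at hg
  rcases hg with ⟨f, rfl⟩ | ⟨_, ⟨_, ⟨f, rfl⟩, _, rfl, rfl⟩, _, ⟨f', rfl⟩, rfl⟩
  · exact horder f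
  · exact mul_mem (mul_mem (horder f) hneg) (horder f')

theorem exists_continuous_coe_eq_of_apply_infty {X : Type*} [TopologicalSpace X]
    (g : OnePoint X ≃ₜ OnePoint X) (hg : g ∞ = ∞) :
    ∃ k : X → X, Continuous k ∧ ∀ x : X, (k x : OnePoint X) = g x := by
  have hne : ∀ x : X, ∃ y : X, (y : OnePoint X) = g x := fun x => by
    rw [← ne_infty_iff_exists, ← hg]
    exact fun h => coe_ne_infty x (g.injective h)
  choose k hk using hne
  refine ⟨k, isOpenEmbedding_coe.isEmbedding.continuous_iff.2 ?_, hk⟩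
  exact (g.continuous.comp continuous_coe).congr fun x => (hk x).symm

theorem exists_onePointCongr_eq_of_apply_infty {X : Type*} [TopologicalSpace X]
    {g : OnePoint X ≃ₜ OnePoint X} (hg : g ∞ = ∞) : ∃ k : X ≃ₜ X, k.onePointCongr = g := by
  obtain ⟨k, hk, hkg⟩ := exists_continuous_coe_eq_of_apply_infty g hg
  obtain ⟨k', hk', hkg'⟩ :=
    exists_continuous_coe_eq_of_apply_infty g.symm (g.symm_apply_eq.2 hg.symm)
  refine ⟨⟨⟨k, k', fun x => ?_, fun x => ?_⟩, hk, hk'⟩, Homeomorph.ext fun x => ?_⟩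
  · rw [← coe_eq_coe, hkg', hkg, g.symm_apply_apply]
  · rw [← coe_eq_coe, hkg, hkg', g.apply_symm_apply]
  · cases x with
    | infty => exact hg.symm
    | coe x => exact hkg x

theorem exists_orderIso_toHomeomorph_eq (k : ℝ ≃ₜ ℝ) :
    ∃ f : ℝ ≃o ℝ, k = f.toHomeomorph ∨ k = f.toHomeomorph.trans (Homeomorph.neg ℝ) := by
  rcases k.continuous.strictMono_of_inj k.injective with h | h
  · exact ⟨h.orderIsoOfSurjective k k.surjective, .inl (Homeomorph.ext fun x => rfl)⟩
  · exact ⟨h.neg.orderIsoOfSurjective _ (neg_surjective.comp k.surjective),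
      .inr (Homeomorph.ext fun x => (neg_neg (k x)).symm)⟩

theorem isStronglyBounded_homeomorph_onePoint_real :
    IsStronglyBounded (univ : Set (OnePoint ℝ ≃ₜ OnePoint ℝ)) := by
  have hpos := isStronglyBounded_circularAut.comap_of_le_range (onePointPermHom_injective ℝ)
    circularAut_le_range_onePointPermHom
  set P := (circularAut (WithTop ℝ)).comap (onePointPermHom ℝ)
  have horder : ∀ f : ℝ ≃o ℝ, f.toHomeomorph.onePointCongr ∈ P := fun f => by
    rw [Subgroup.mem_comap, onePointPermHom_onePointCongr_toHomeomorph]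
    exact (ofOrderIso f).2
  refine (hpos.union ((hpos.mul (.singleton (Homeomorph.neg ℝ).onePointCongr)).mul hpos)).mono
    fun g _ => ?_
  obtain ⟨p, hpP, hp⟩ : ∃ p ∈ P, p ∞ = g ∞ := by
    obtain ⟨q, hq⟩ := exists_circularAut_smul_top_eq (onePointEquivWithTop ℝ (g ∞))
    obtain ⟨p, hp⟩ := circularAut_le_range_onePointPermHom q.2
    refine ⟨p, Subgroup.mem_comap.2 (hp ▸ q.2), (onePointEquivWithTop ℝ).injective ?_⟩
    exact (DFunLike.congr_fun hp ⊤).trans hq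
  obtain ⟨k, hk⟩ := exists_onePointCongr_eq_of_apply_infty (g := p⁻¹ * g)
    ((congrArg p.symm hp.symm).trans (p.symm_apply_apply ∞))
  obtain rfl : p * k.onePointCongr = g := by rw [hk, mul_inv_cancel_left]
  obtain ⟨f, rfl | rfl⟩ := exists_orderIso_toHomeomorph_eq k
  · exact .inl (mul_mem hpP (horder f))
  · refine .inr ⟨_, mul_mem_mul hpP rfl, _, horder f, ?_⟩
    exact Homeomorph.ext fun x => by cases x <;> rfl

theorem nonempty_homeomorph_unitAddCircle_onePoint_real :
    Nonempty (UnitAddCircle ≃ₜ OnePoint ℝ) := by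
  have e₁ : UnitAddCircle ≃ₜ Circle := AddCircle.homeomorphCircle one_ne_zero
  have e₂ : Circle ≃ₜ Metric.sphere (0 : EuclideanSpace ℝ (Fin 2)) 1 :=
    Complex.orthonormalBasisOneI.repr.toHomeomorph.subtype
      (p := fun z => z ∈ Metric.sphere 0 1) fun z => by simp
  have e₃ : OnePoint ℝ ≃ₜ Metric.sphere (0 : EuclideanSpace ℝ (Fin 2)) 1 :=
    onePointEquivSphereOfFinrankEq (by simp)
  exact ⟨(e₁.trans e₂).trans e₃.symm⟩

theorem IsStronglyBounded.homeomorph_congr {X Y : Type*} [TopologicalSpace X] [TopologicalSpace Y]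
    (hX : IsStronglyBounded (univ : Set (X ≃ₜ X))) (e : Y ≃ₜ X) :
    IsStronglyBounded (univ : Set (Y ≃ₜ Y)) := by
  let conj : (X ≃ₜ X) →* (Y ≃ₜ Y) :=
    { toFun g := (e.trans g).trans e.symm
      map_one' := Homeomorph.ext e.symm_apply_apply
      map_mul' g h := Homeomorph.ext fun y =>
        congrArg (e.symm ∘ g) (e.apply_symm_apply (h (e y))).symm }
  refine (hX.image conj).mono fun g _ => ⟨(e.symm.trans g).trans e, mem_univ _, ?_⟩
  ext y
  change e.symm (e (g (e.symm (e y)))) = g y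
  rw [e.symm_apply_apply, e.symm_apply_apply]

theorem isBergman_homeomorph_unitAddCircle : IsBergman (UnitAddCircle ≃ₜ UnitAddCircle) := by
  obtain ⟨e⟩ := nonempty_homeomorph_unitAddCircle_onePoint_real
  exact (isStronglyBounded_homeomorph_onePoint_real.homeomorph_congr e).isBergman

end Homeomorph

theorem mainTheorem12 :
    (∀ C : Set UnitAddCircle, C.Countable → Dense C → IsBergman (CircleOrder.aut C)) ∧
      IsBergman (UnitAddCircle ≃ₜ UnitAddCircle) :=
  ⟨fun _ hC hd => CircleOrder.isBergman_aut hC hd, isBergman_homeomorph_unitAddCircle⟩
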